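/- Let $\mathbb H^n_{\mathbb C}$ be complex hyperbolic $n$-space, i.e. the open unit ball of $\mathbb C^n$ with the Bergman metric $d$ normalised to have sectional curvature between $-1$ and $-1/4$, so that $\cosh^2\frac{d(z,w)}2=\frac{|1-\sum_i z_i\bar w_i|^2}{(1-|z|^2)(1-|w|^2)}$. The projective unitary group $PU(n,1)$ acts on the ball and on its closure by fractional linear maps. An element of $PU(n,1)$ is parabolic if it has exactly one fixed point in the closed ball and this point lies on the boundary sphere. For a subgroup $G\subset PU(n,1)$ and a point $y\in\mathbb H^n_{\mathbb C}$ the Dirichlet polyhedron centered at $y$ is $$D_y(G)=\{z\in\mathbb H^n_{\mathbb C} : d(z,y)\le d(z,gy)\ \text{ for all } g\in G\},$$ and a side of $D_y(G)$ is a set of the form $D_y(G)\cap B$, where $B=\{z\in\mathbb H^n_{\mathbb C} : d(z,y)=d(z,gy)\}$ for some $g\in G$ with $gy\neq y$, that contains a nonempty relatively open subset of the hypersurface $B$. **Theorem 3.1.** For any discrete group $G\subset PU(n,1)$ generated by a single parabolic element, there is a point $y_0\in\mathbb H^n_{\mathbb C}$ such that the Dirichlet polyhedron $D_{y_0}(G)$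 has exactly two sides. -/

import Mathlib

open scoped Matrix

noncomputable section

namespace ComplexHyperbolic

/-! ## The Hermitian form of signature `(n,1)` and the group `PU(n,1)` -/

/-- The standard Hermitian form of signature `(n,1)` on `ℂⁿ ⊕ ℂ`:
`⟨v,w⟩ = v₁ w̄₁ + ⋯ + vₙ w̄ₙ - vₙ₊₁ w̄ₙ₊₁`. -/
def herm {n : ℕ} (v w : Fin n ⊕ Unit → ℂ) : ℂ :=
  (∑ i, v (Sum.inl i) * star (w (Sum.inl i))) - v (Sum.inr ()) * star (w (Sum.inr ()))

/-- The unitary group `U(n,1)`: the invertible complex matrices that preserve the form. -/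
def U (n : ℕ) : Subgroup (GL (Fin n ⊕ Unit) ℂ) where
  carrier := {A | ∀ v w, herm (A.val *ᵥ v) (A.val *ᵥ w) = herm v w}
  one_mem' := by
    intro v w
    simp
  mul_mem' := by
    intro A B hA hB v w
    simp only [Units.val_mul, ← Matrix.mulVec_mulVec]
    rw [hA, hB]
  inv_mem' := by
    intro A hA v w
    rw [← hA]
    simp only [Matrix.mulVec_mulVec, Units.mul_inv, Matrix.one_mulVec]

/-- The subgroup of scalar matrices in `U(n,1)`. -/
def scalars (n : ℕ) : Subgroup (U n) :=
  (Matrix.GeneralLinearGroup.scalar (R := ℂ) (Fin n ⊕ Unit)).range.subgroupOf (U n)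

instance scalars_normal (n : ℕ) : (scalars n).Normal where
  conj_mem := by
    rintro A ⟨c, hc⟩ B
    refine ⟨c, ?_⟩
    have h := Matrix.GeneralLinearGroup.scalar_commute c (B : GL (Fin n ⊕ Unit) ℂ)
    change _ = (A : GL (Fin n ⊕ Unit) ℂ) at hc
    change _ = (B : GL (Fin n ⊕ Unit) ℂ) * (A : GL (Fin n ⊕ Unit) ℂ) * (B : GL (Fin n ⊕ Unit) ℂ)⁻¹
    rw [← hc, ← h, mul_inv_cancel_right]

/-- The projective unitary group `PU(n,1) = U(n,1) / {scalars}`; it carries the quotient of the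
topology that `U(n,1)` inherits from the complex matrices. -/
abbrev PU (n : ℕ) : Type := U n ⧸ scalars n

/-! ## The ball model and the action of `PU(n,1)` -/

/-- Complex hyperbolic `n`-space (as a set): the open unit ball of `ℂⁿ`. -/
abbrev CH (n : ℕ) : Type := Metric.ball (0 : EuclideanSpace ℂ (Fin n)) 1

/-- Complex hyperbolic `n`-space with its boundary at infinity: the closed unit ball of `ℂⁿ`. -/
abbrev CHbar (n : ℕ) : Type := Metric.closedBall (0 : EuclideanSpace ℂ (Fin n)) 1

/-- Homogeneous coordinates `(z, 1)` of a point `z` of `ℂⁿ`. -/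
def homog {n : ℕ} (z : EuclideanSpace ℂ (Fin n)) : Fin n ⊕ Unit → ℂ :=
  Sum.elim (fun i => z i) (fun _ => 1)

/-- The point of `ℂⁿ` with homogeneous coordinates `v` (meaningful for `vₙ₊₁ ≠ 0`). -/
def dehomog {n : ℕ} (v : Fin n ⊕ Unit → ℂ) : EuclideanSpace ℂ (Fin n) :=
  WithLp.toLp 2 (fun i => v (Sum.inl i) / v (Sum.inr ()))

theorem herm_self {n : ℕ} (v : Fin n ⊕ Unit → ℂ) :
    herm v v = (((∑ i, ‖v (Sum.inl i)‖ ^ 2) - ‖v (Sum.inr ())‖ ^ 2 : ℝ) : ℂ) := by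
  simp [herm, Complex.mul_conj, Complex.normSq_eq_norm_sq]

theorem herm_homog_self {n : ℕ} (z : EuclideanSpace ℂ (Fin n)) :
    herm (homog z) (homog z) = ((‖z‖ ^ 2 - 1 : ℝ) : ℂ) := by
  rw [herm_self, EuclideanSpace.norm_sq_eq]
  simp [homog]

theorem norm_dehomog {n : ℕ} (v : Fin n ⊕ Unit → ℂ) :
    ‖dehomog v‖ ^ 2 * ‖v (Sum.inr ())‖ ^ 2 =
      if v (Sum.inr ()) = 0 then 0 else ∑ i, ‖v (Sum.inl i)‖ ^ 2 := by
  split_ifs with h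
  · simp [h]
  · have h' : ‖v (Sum.inr ())‖ ^ 2 ≠ 0 := by simpa using h
    rw [EuclideanSpace.norm_sq_eq, Finset.sum_mul]
    refine Finset.sum_congr rfl fun i _ => ?_
    simp only [dehomog, norm_div, div_pow]
    exact div_mul_cancel₀ _ h'

theorem last_ne_zero {n : ℕ} (A : U n) (z : CHbar n) :
    (A.1.val *ᵥ homog z.1) (Sum.inr ()) ≠ 0 := by
  intro h0
  have h1 := A.2 (homog z.1) (homog z.1)
  have hz : ‖z.1‖ ≤ 1 := mem_closedBall_zero_iff.1 z.2
  rw [herm_self, herm_homog_self, h0] at h1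
  have h2 := Complex.ofReal_injective h1
  have h3 : ∑ i, ‖(A.1.val *ᵥ homog z.1) (Sum.inl i)‖ ^ 2 = 0 := by
    refine le_antisymm ?_ (Finset.sum_nonneg fun i _ => by positivity)
    simp only [norm_zero] at h2
    nlinarith [norm_nonneg z.1]
  rw [Finset.sum_eq_zero_iff_of_nonneg (fun i _ => by positivity)] at h3
  have h4 : A.1.val *ᵥ homog z.1 = 0 := by
    funext j
    rcases j with i | u
    · simpa using h3 i (Finset.mem_univ i)
    · exact h0
  have h5 : homog z.1 = 0 := by
    have : (A.1⁻¹).val *ᵥ (A.1.val *ᵥ homog z.1) = 0 := by rw [h4, Matrix.mulVec_zero]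
    simpa only [Matrix.mulVec_mulVec, Units.inv_mul, Matrix.one_mulVec] using this
  simpa [homog] using congrFun h5 (Sum.inr ())

/-- `U(n,1)` acts on the ball by fractional linear maps. -/
def frac {n : ℕ} (A : U n) (z : EuclideanSpace ℂ (Fin n)) : EuclideanSpace ℂ (Fin n) :=
  dehomog (A.1.val *ᵥ homog z)

theorem frac_norm {n : ℕ} (A : U n) (z : CHbar n) :
    (‖frac A z.1‖ ^ 2 - 1) * ‖(A.1.val *ᵥ homog z.1) (Sum.inr ())‖ ^ 2 = ‖z.1‖ ^ 2 - 1 := by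
  have h1 := A.2 (homog z.1) (homog z.1)
  rw [herm_self, herm_homog_self] at h1
  have h2 := Complex.ofReal_injective h1
  have h3 := norm_dehomog (A.1.val *ᵥ homog z.1)
  rw [if_neg (last_ne_zero A z)] at h3
  rw [sub_mul, frac, h3, one_mul, h2]

theorem frac_norm_le {n : ℕ} (A : U n) (z : CHbar n) : ‖frac A z.1‖ ≤ 1 := by
  have h := frac_norm A z
  have hp : 0 < ‖(A.1.val *ᵥ homog z.1) (Sum.inr ())‖ ^ 2 := by
    have := norm_pos_iff.2 (last_ne_zero A z)
    positivity
  have hz : ‖z.1‖ ≤ 1 := mem_closedBall_zero_iff.1 z.2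
  by_contra! hc
  have : 0 < (‖frac A z.1‖ ^ 2 - 1) * ‖(A.1.val *ᵥ homog z.1) (Sum.inr ())‖ ^ 2 :=
    mul_pos (by nlinarith) hp
  nlinarith [norm_nonneg z.1]

theorem frac_norm_lt {n : ℕ} (A : U n) (z : CHbar n) (hz : ‖z.1‖ < 1) : ‖frac A z.1‖ < 1 := by
  have h := frac_norm A z
  by_contra! hc
  have : 0 ≤ (‖frac A z.1‖ ^ 2 - 1) * ‖(A.1.val *ᵥ homog z.1) (Sum.inr ())‖ ^ 2 :=
    mul_nonneg (by nlinarith) (by positivity)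
  nlinarith [norm_nonneg z.1]

theorem dehomog_smul {n : ℕ} (c : ℂ) (hc : c ≠ 0) (v : Fin n ⊕ Unit → ℂ) :
    dehomog (c • v) = dehomog v := by
  ext i
  simp [dehomog, mul_div_mul_left _ _ hc]

theorem dehomog_homog {n : ℕ} (z : EuclideanSpace ℂ (Fin n)) : dehomog (homog z) = z := by
  ext i
  simp [dehomog, homog]

theorem homog_dehomog {n : ℕ} (v : Fin n ⊕ Unit → ℂ) (hv : v (Sum.inr ()) ≠ 0) :
    homog (dehomog v) = (v (Sum.inr ()))⁻¹ • v := by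
  funext j
  rcases j with i | u
  · simp [homog, dehomog, div_eq_inv_mul]
  · simp [homog, hv]

theorem frac_mul {n : ℕ} (A B : U n) (z : CHbar n) :
    frac (A * B) z.1 = frac A (frac B z.1) := by
  have hB := last_ne_zero B z
  simp only [frac]
  rw [homog_dehomog _ hB, Matrix.mulVec_smul, dehomog_smul _ (inv_ne_zero hB),
    Matrix.mulVec_mulVec]
  rfl

/-- The action of `U(n,1)` on the closed ball. -/
instance actU (n : ℕ) : MulAction (U n) (CHbar n) where
  smul A z := ⟨frac A z.1, by simpa using frac_norm_le A z⟩
  one_smul z := by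
    apply Subtype.ext
    change frac 1 z.1 = z.1
    simp [frac, dehomog_homog]
  mul_smul A B z := by
    apply Subtype.ext
    exact frac_mul A B z

theorem scalars_act {n : ℕ} (A : U n) (hA : A ∈ scalars n) :
    MulAction.toPermHom (U n) (CHbar n) A = 1 := by
  obtain ⟨c, hc⟩ := hA
  change _ = (A : GL (Fin n ⊕ Unit) ℂ) at hc
  ext1 z
  apply Subtype.ext
  change dehomog (A.1.val *ᵥ homog z.1) = z.1
  rw [← hc, Matrix.GeneralLinearGroup.coe_scalar]
  have : Matrix.scalar (Fin n ⊕ Unit) (c : ℂ) *ᵥ homog z.1 = (c : ℂ) • homog z.1 := by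
    funext j
    simp [Matrix.mulVec_diagonal]
  rw [this, dehomog_smul _ c.ne_zero, dehomog_homog]

/-- The action of `PU(n,1)` on the closed ball, induced by that of `U(n,1)`. -/
instance actBar (n : ℕ) : MulAction (PU n) (CHbar n) :=
  MulAction.compHom (CHbar n)
    (QuotientGroup.lift (scalars n) (MulAction.toPermHom (U n) (CHbar n)) scalars_act)

theorem mk_smul {n : ℕ} (A : U n) (z : CHbar n) : ((A : PU n) • z).1 = frac A z.1 := rfl

/-- A point of the open ball as a point of the closed ball. -/
def toBar {n : ℕ} (z : CH n) : CHbar n := ⟨z.1, Metric.ball_subset_closedBall z.2⟩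

theorem smul_mem_ball {n : ℕ} (g : PU n) (z : CH n) :
    (g • toBar z).1 ∈ Metric.ball (0 : EuclideanSpace ℂ (Fin n)) 1 := by
  induction g using QuotientGroup.induction_on with
  | H A =>
    rw [mk_smul]
    exact mem_ball_zero_iff.2 (frac_norm_lt A (toBar z) (mem_ball_zero_iff.1 z.2))

/-- The action of `PU(n,1)` on complex hyperbolic space, by restriction. -/
instance act (n : ℕ) : MulAction (PU n) (CH n) where
  smul g z := ⟨(g • toBar z).1, smul_mem_ball g z⟩
  one_smul z := by
    apply Subtype.ext
    change ((1 : PU n) • toBar z).1 = z.1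
    rw [one_smul]
    rfl
  mul_smul g h z := by
    apply Subtype.ext
    change ((g * h) • toBar z).1 = _
    rw [mul_smul]
    rfl

/-- An element of `PU(n,1)` is parabolic if it has exactly one fixed point in the closed ball,
and this point lies on the boundary sphere. -/
def IsParabolic {n : ℕ} (g : PU n) : Prop :=
  ∃ p : CHbar n, ‖p.1‖ = 1 ∧ ∀ q : CHbar n, g • q = q ↔ q = p

/-! ## The Bergman metric, bisectors and Dirichlet polyhedra -/

/-- The distance of the Bergman metric on the ball, normalised to have sectional curvature
between `-1` and `-1/4`: for `Z = (z,1)`, `W = (w,1)`,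
`cosh² (d(z,w) / 2) = ⟨Z,W⟩ ⟨W,Z⟩ / (⟨Z,Z⟩ ⟨W,W⟩)`. -/
def bdist {n : ℕ} (z w : CH n) : ℝ :=
  2 * Real.arcosh (‖herm (homog z.1) (homog w.1)‖ /
    √((herm (homog z.1) (homog z.1)).re * (herm (homog w.1) (homog w.1)).re))

/-- The bisector (equidistant hypersurface) of two points. -/
def bisector {n : ℕ} (y y' : CH n) : Set (CH n) := {z | bdist z y = bdist z y'}

/-- The Dirichlet polyhedron of `G` centred at `y`. -/
def dirichlet {n : ℕ} (G : Subgroup (PU n)) (y : CH n) : Set (CH n) :=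
  {z | ∀ g ∈ G, bdist z y ≤ bdist z (g • y)}

/-- `S` is a side of the Dirichlet polyhedron `D` of `G` centred at `y`: it is the intersection
of `D` with the bisector of `y` and some `g y ≠ y`, `g ∈ G`, and it has codimension one, i.e. it
contains a nonempty relatively open subset of that bisector. -/
def IsSide {n : ℕ} (G : Subgroup (PU n)) (y : CH n) (S : Set (CH n)) : Prop :=
  ∃ g ∈ G, g • y ≠ y ∧ S = dirichlet G y ∩ bisector y (g • y) ∧
    ∃ V : Set (CH n), IsOpen V ∧ (V ∩ bisector y (g • y)).Nonempty ∧
      V ∩ bisector y (g • y) ⊆ S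

end ComplexHyperbolic

end

/-! # Dirichlet polyhedra of cyclic parabolic groups in complex hyperbolic space -/

/-! Lift the generator g to an isometry of the form, and let p be a null vector over its fixed
point. The eigenvalue of p has modulus one, for otherwise a second fixed point would appear on the
sphere (`exists_null_eigenvector`); rescale the lift to T with T p = p. The form is positive
definite on p^⊥/p, so T has no unipotent part there, and some negative vector y satisfies (T - 1)² y
∈ ℂp (`exists_negative_transverse`). It represents the centre. Its orbit T^k y = y + k t +
(k(k-1)/2) s p is quadratic in k, with s = ⟨t,t⟩ ≥ 0. If z is scaled so that ⟨z,p⟩ = -1, then ⟨z,T^k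
y⟩ has a negative concave quadratic real part and an affine imaginary part. Its squared modulus is
therefore strictly convex in real k (`strictConvexOn_herm_orbitCurve`), and the distance from z to
g^k y is an increasing function of it.

A strictly convex F with F(0) ≤ F(1) and F(0) ≤ F(-1) has F(0) < F(k) at all other nonzero integers
k, and F(0) = F(1) forces F(0) < F(-1). So only the bisectors for g and g⁻¹ meet the polyhedron;
they lie wholly inside it and are disjoint. -/

namespace ComplexHyperbolic

/-! ### Negative and null vectors of the Hermitian form. -/

section Form

variable {n : ℕ}

theorem herm_add_left (u v w : Fin n ⊕ Unit → ℂ) : herm (u + v) w = herm u w + herm v w := by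
  simp only [herm, Pi.add_apply, add_mul, Finset.sum_add_distrib]; ring

theorem herm_smul_left (c : ℂ) (v w : Fin n ⊕ Unit → ℂ) : herm (c • v) w = c * herm v w := by
  simp only [herm, Pi.smul_apply, smul_eq_mul, mul_sub, Finset.mul_sum, mul_assoc]

theorem star_herm (v w : Fin n ⊕ Unit → ℂ) : star (herm v w) = herm w v := by
  simp only [herm, star_sub, star_sum, star_mul', star_star, mul_comm]

theorem herm_add_right (u v w : Fin n ⊕ Unit → ℂ) : herm u (v + w) = herm u v + herm u w := by
  rw [← star_herm, herm_add_left, star_add, star_herm, star_herm]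

theorem herm_smul_right (c : ℂ) (v w : Fin n ⊕ Unit → ℂ) :
    herm v (c • w) = star c * herm v w := by
  rw [← star_herm, herm_smul_left, star_mul', star_herm]

theorem herm_sub_left (u v w : Fin n ⊕ Unit → ℂ) : herm (u - v) w = herm u w - herm v w := by
  rw [sub_eq_add_neg, ← neg_one_smul ℂ v, herm_add_left, herm_smul_left]; ring

theorem herm_sub_right (u v w : Fin n ⊕ Unit → ℂ) : herm u (v - w) = herm u v - herm u w := by
  rw [← star_herm, herm_sub_left, star_sub, star_herm, star_herm]

theorem herm_zero_left (w : Fin n ⊕ Unit → ℂ) : herm 0 w = 0 := by simp [herm]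

theorem herm_re_comm (v w : Fin n ⊕ Unit → ℂ) : (herm v w).re = (herm w v).re := by
  rw [← star_herm w v]; simp

theorem herm_self_im (v : Fin n ⊕ Unit → ℂ) : (herm v v).im = 0 := by
  rw [herm_self]; exact Complex.ofReal_im _

theorem herm_self_eq_re (v : Fin n ⊕ Unit → ℂ) : herm v v = ((herm v v).re : ℂ) :=
  Complex.ext rfl (by simp [herm_self_im])

/-- A vector whose last coordinate vanishes is positive. -/
theorem herm_self_nonneg_of_last_eq_zero {v : Fin n ⊕ Unit → ℂ} (hv : v (Sum.inr ()) = 0) :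
    0 ≤ (herm v v).re ∧ ((herm v v).re = 0 → v = 0) := by
  have h : (herm v v).re = ∑ i, ‖v (Sum.inl i)‖ ^ 2 := by
    rw [herm_self, hv, Complex.ofReal_re]; simp
  rw [h]
  refine ⟨Finset.sum_nonneg fun i _ => by positivity, fun h0 => ?_⟩
  rw [Finset.sum_eq_zero_iff_of_nonneg (fun i _ => by positivity)] at h0
  funext j
  rcases j with i | u
  · simpa using h0 i (Finset.mem_univ i)
  · exact hv

theorem last_ne_zero_of_nonpos {v : Fin n ⊕ Unit → ℂ} (hv : v ≠ 0) (h : (herm v v).re ≤ 0) :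
    v (Sum.inr ()) ≠ 0 := fun h0 =>
  hv ((herm_self_nonneg_of_last_eq_zero h0).2
    (le_antisymm h (herm_self_nonneg_of_last_eq_zero h0).1))

theorem herm_smul_self_re (c : ℂ) (v : Fin n ⊕ Unit → ℂ) :
    (herm (c • v) (c • v)).re = ‖c‖ ^ 2 * (herm v v).re := by
  rw [herm_smul_left, herm_smul_right, ← mul_assoc]
  have : c * star c = ((‖c‖ ^ 2 : ℝ) : ℂ) := by simpa using Complex.mul_conj' c
  rw [this, Complex.re_ofReal_mul]

/-- Two negative vectors are never orthogonal. -/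
theorem herm_ne_zero_of_neg {v w : Fin n ⊕ Unit → ℂ} (hv : (herm v v).re < 0)
    (hw : (herm w w).re < 0) : herm v w ≠ 0 := by
  intro h
  have h' : herm w v = 0 := by rw [← star_herm, h, star_zero]
  have hv0 : v (Sum.inr ()) ≠ 0 := last_ne_zero_of_nonpos (by
    rintro rfl; simp [herm_zero_left] at hv) hv.le
  -- This combination has last coordinate zero, so its norm is nonnegative; orthogonality would make
  -- that norm negative.
  have h1 := (herm_self_nonneg_of_last_eq_zero
    (v := w (Sum.inr ()) • v - v (Sum.inr ()) • w) (by simp [mul_comm])).1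
  have h2 : (herm (w (Sum.inr ()) • v - v (Sum.inr ()) • w)
      (w (Sum.inr ()) • v - v (Sum.inr ()) • w)).re =
      ‖w (Sum.inr ())‖ ^ 2 * (herm v v).re + ‖v (Sum.inr ())‖ ^ 2 * (herm w w).re := by
    rw [← herm_smul_self_re, ← herm_smul_self_re]
    simp only [herm_sub_left, herm_sub_right, herm_smul_left, herm_smul_right, h, h', mul_zero,
      sub_zero, zero_sub, mul_neg, sub_neg_eq_add, Complex.add_re]
  have h3 : 0 < ‖v (Sum.inr ())‖ ^ 2 := by have := norm_pos_iff.2 hv0; positivity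
  nlinarith [sq_nonneg ‖w (Sum.inr ())‖, mul_pos_of_neg_of_neg hv hw]

variable {p : Fin n ⊕ Unit → ℂ}

/-- The orthogonal complement of a null vector is positive semidefinite, with kernel spanned by
the null vector. -/
theorem herm_self_of_orthogonal_null (hp : herm p p = 0) (hp1 : p (Sum.inr ()) = 1)
    {v : Fin n ⊕ Unit → ℂ} (hv : herm v p = 0) :
    0 ≤ (herm v v).re ∧ ((herm v v).re = 0 → ∃ c : ℂ, v = c • p) := by
  have hv' : herm p v = 0 := by rw [← star_herm, hv, star_zero]
  -- Subtracting a multiple of p does not change the norm, and this multiple kills the last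
  -- coordinate.
  have h : herm (v - v (Sum.inr ()) • p) (v - v (Sum.inr ()) • p) = herm v v := by
    simp [herm_sub_left, herm_sub_right, herm_smul_left, herm_smul_right, hv, hv', hp]
  have h2 := herm_self_nonneg_of_last_eq_zero (v := v - v (Sum.inr ()) • p) (by simp [hp1])
  rw [h] at h2
  exact ⟨h2.1, fun h0 => ⟨_, sub_eq_zero.1 (h2.2 h0)⟩⟩

theorem herm_null_ne_zero (hp : herm p p = 0) (hp1 : p (Sum.inr ()) = 1)
    {v : Fin n ⊕ Unit → ℂ} (hv : (herm v v).re < 0) : herm v p ≠ 0 := fun h =>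
  absurd (herm_self_of_orthogonal_null hp hp1 h).1 (not_le.2 hv)

/-- Two negative vectors of equal norm have a negative equidistant vector. -/
theorem exists_equidistant {u v : Fin n ⊕ Unit → ℂ} (hu : (herm u u).re < 0)
    (huv : herm u u = herm v v) :
    ∃ z, (herm z z).re < 0 ∧ ‖herm z u‖ = ‖herm z v‖ := by
  -- The phase c makes the pairing real and nonpositive, so that u + c v is negative and pairs
  -- equally with u and c v.
  obtain ⟨c, hc, hcw⟩ : ∃ c : ℂ, ‖c‖ = 1 ∧ herm u (c • v) = ((-‖herm u v‖ : ℝ) : ℂ) := by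
    by_cases h0 : herm u v = 0
    · exact ⟨1, by simp, by simp [h0]⟩
    · have h1 : (‖herm u v‖ : ℂ) ≠ 0 := by simpa using h0
      refine ⟨-(herm u v / ‖herm u v‖), by simp [h0], ?_⟩
      rw [herm_smul_right]
      have h2 : star (herm u v) * herm u v = (‖herm u v‖ : ℂ) ^ 2 := by
        simpa using Complex.conj_mul' (herm u v)
      have h3 : star (-(herm u v / (‖herm u v‖ : ℂ))) = -(star (herm u v) / (‖herm u v‖ : ℂ)) := by
        simp
      rw [h3, neg_mul, div_mul_eq_mul_div, h2]
      push_cast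
      field_simp
  have hcw' : herm (c • v) u = ((-‖herm u v‖ : ℝ) : ℂ) := by
    rw [← star_herm, hcw]; simp
  have hcc : herm (c • v) (c • v) = herm u u := by
    rw [herm_smul_left, herm_smul_right, ← mul_assoc, huv]
    have : c * star c = 1 := by simpa [hc] using Complex.mul_conj' c
    rw [this, one_mul]
  refine ⟨u + c • v, ?_, ?_⟩
  · rw [herm_add_left, herm_add_right, herm_add_right, hcc, hcw, hcw']
    simp only [Complex.add_re, Complex.ofReal_re]
    linarith [norm_nonneg (herm u v)]
  · have h1 : herm (u + c • v) (c • v) = herm (u + c • v) u := by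
      rw [herm_add_left, herm_add_left, hcc, hcw, hcw']; ring
    rw [← h1, herm_smul_right, norm_mul, norm_star, hc, one_mul]

end Form

/-! ### Isometries with a null eigenvector. -/

section Isometry

variable {n : ℕ} {T : (Fin n ⊕ Unit → ℂ) →ₗ[ℂ] (Fin n ⊕ Unit → ℂ)} {p : Fin n ⊕ Unit → ℂ}

/-- An isometry that has a null eigenvector with an eigenvalue off the unit circle has a second
null eigenvector. -/
theorem exists_null_eigenvector (hT : ∀ v w, herm (T v) (T w) = herm v w)
    (hp1 : p (Sum.inr ()) = 1) {l : ℂ} (hl0 : l ≠ 0) (hl : ‖l‖ ≠ 1)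
    (hTp : T p = l • p) :
    ∃ w : Fin n ⊕ Unit → ℂ, ∃ m : ℂ, w ≠ 0 ∧ m ≠ 0 ∧ herm w w = 0 ∧ T w = m • w ∧
      ∀ c : ℂ, w ≠ c • p := by
  have hsl : star l ≠ 0 := by simpa using hl0
  -- Invariance of ⟨v,p⟩ singles out this m: T - m maps into the proper subspace p^⊥, so m is an
  -- eigenvalue. As |m| ≠ 1, its eigenvectors are null.
  set m : ℂ := (star l)⁻¹ with hm
  have hm0 : m ≠ 0 := inv_ne_zero hsl
  have hmn : ‖m‖ = ‖l‖⁻¹ := by rw [hm, norm_inv, norm_star]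
  set N : (Fin n ⊕ Unit → ℂ) →ₗ[ℂ] (Fin n ⊕ Unit → ℂ) := T - m • LinearMap.id with hN
  have horth : ∀ v, herm (N v) p = 0 := by
    intro v
    have h := hT v p
    rw [hTp, herm_smul_right] at h
    simp only [hN, LinearMap.sub_apply, LinearMap.smul_apply, LinearMap.id_apply]
    rw [herm_sub_left, herm_smul_left, ← h, hm, inv_mul_cancel_left₀ hsl, sub_self]
  have hns : ¬ Function.Surjective N := by
    intro hs
    obtain ⟨v, hv⟩ := hs (Pi.single (Sum.inr ()) 1)
    have := horth v
    rw [hv] at this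
    simp [herm, hp1] at this
  have hni : ¬ Function.Injective N := fun hi =>
    hns (LinearMap.injective_iff_surjective.1 hi)
  obtain ⟨w, hw, hw0⟩ : ∃ w, N w = 0 ∧ w ≠ 0 := by
    by_contra! hc
    exact hni ((injective_iff_map_eq_zero _).2 hc)
  have hTw : T w = m • w := by simpa [hN, sub_eq_zero] using hw
  have hne : ‖m‖ ≠ 1 := by rw [hmn]; simpa using hl
  refine ⟨w, m, hw0, hm0, ?_, hTw, ?_⟩
  · have h := hT w w
    rw [hTw, herm_smul_left, herm_smul_right, ← mul_assoc] at h
    have h1 : m * star m = ((‖m‖ ^ 2 : ℝ) : ℂ) := by simpa using Complex.mul_conj' m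
    by_contra h0
    have h2 := mul_right_cancel₀ h0 (h.trans (one_mul _).symm)
    rw [h1] at h2
    have h3 : ‖m‖ ^ 2 = 1 := by exact_mod_cast h2
    exact hne (by nlinarith [norm_nonneg m])
  · rintro c rfl
    have hc : c • p ≠ 0 := hw0
    rw [map_smul, hTp, smul_comm] at hTw
    have h4 : l = m := smul_left_injective ℂ hc hTw
    have h5 : ‖l‖ = ‖l‖⁻¹ := by rw [← hmn, ← h4]
    have h6 : ‖l‖ * ‖l‖ = 1 := by
      nth_rewrite 2 [h5]
      exact mul_inv_cancel₀ (by simpa using hl0)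
    exact hl (by nlinarith [norm_nonneg l])

/-- The map induced by an isometry on `p^⊥ / p` has no nontrivial unipotent part. -/
theorem sub_mem_span_of_pow (hT : ∀ v w, herm (T v) (T w) = herm v w)
    (hp : herm p p = 0) (hp1 : p (Sum.inr ()) = 1) (hTp : T p = p) (j : ℕ)
    {w : Fin n ⊕ Unit → ℂ} (hw : herm w p = 0)
    (h : ∃ c : ℂ, ((T - 1) ^ (j + 1)) w = c • p) : ∃ c : ℂ, T w - w = c • p := by
  have key : ∀ w : Fin n ⊕ Unit → ℂ, herm w p = 0 → herm (T w - w) p = 0 := by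
    intro w hw
    have h := hT w p
    rw [hTp] at h
    rw [herm_sub_left, h, sub_self]
  induction j generalizing w with
  | zero => simpa using h
  | succ j ih =>
    have h1 : ∃ c : ℂ, T (T w - w) - (T w - w) = c • p := by
      refine ih (key w hw) ?_
      obtain ⟨c, hc⟩ := h
      refine ⟨c, ?_⟩
      rw [pow_succ, Module.End.mul_apply] at hc
      simpa using hc
    obtain ⟨c, hc⟩ := h1
    set u := T w - w with hu
    have hTw : T w = w + u := by rw [hu]; abel
    have hTu : T u = u + c • p := by rw [← hc]; abel
    -- Since w and u are orthogonal to p, invariance leaves ⟨u,u⟩ = 0, which puts u in the kernel ℂp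
    -- of the form on p^⊥.
    have h2 := hT w u
    rw [hTw, hTu, herm_add_left, herm_add_right, herm_add_right, herm_smul_right,
      herm_smul_right, hw, key w hw] at h2
    have h3 : herm u u = 0 := by linear_combination h2
    refine (herm_self_of_orthogonal_null hp hp1 (key w hw)).2 ?_
    change (herm u u).re = 0
    rw [h3, Complex.zero_re]

/-- A unipotent-like vector transverse to `p^⊥`. -/
theorem exists_transverse (hT : ∀ v w, herm (T v) (T w) = herm v w)
    (hp : herm p p = 0) (hp1 : p (Sum.inr ()) = 1) (hTp : T p = p) :
    ∃ v : Fin n ⊕ Unit → ℂ, herm v p ≠ 0 ∧ ∃ s : ℂ, T (T v - v) - (T v - v) = s • p := by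
  have key : ∀ w : Fin n ⊕ Unit → ℂ, herm ((T - 1) w) p = 0 := by
    intro w
    have h := hT w p
    rw [hTp] at h
    simp [herm_sub_left, h]
  -- Fitting decomposition of T - 1. The range part is orthogonal to p, so a vector not orthogonal
  -- to p has a generalised 1-eigencomponent that is not orthogonal to p either.
  obtain ⟨m, hm⟩ := Filter.eventually_atTop.1
    (LinearMap.eventually_isCompl_ker_pow_range_pow (T - 1 : Module.End ℂ (Fin n ⊕ Unit → ℂ)))
  have hc := hm (m + 2) (by omega)
  have htop : (Pi.single (Sum.inr ()) 1 : Fin n ⊕ Unit → ℂ) ∈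
      LinearMap.ker ((T - 1 : Module.End ℂ (Fin n ⊕ Unit → ℂ)) ^ (m + 2)) ⊔
      LinearMap.range ((T - 1 : Module.End ℂ (Fin n ⊕ Unit → ℂ)) ^ (m + 2)) := by
    rw [hc.sup_eq_top]; trivial
  obtain ⟨v, hv, r, ⟨u, rfl⟩, hvr⟩ := Submodule.mem_sup.1 htop
  refine ⟨v, ?_, ?_⟩
  · intro h0
    have h1 : herm (Pi.single (Sum.inr ()) 1) p = 0 := by
      rw [← hvr, herm_add_left, h0, zero_add, pow_succ', Module.End.mul_apply]
      exact key _
    simp [herm, hp1] at h1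
  · refine sub_mem_span_of_pow hT hp hp1 hTp m (key v) ⟨0, ?_⟩
    rw [LinearMap.mem_ker, pow_succ, Module.End.mul_apply] at hv
    simpa using hv

/-- A negative vector normalised against `p` whose orbit is polynomial of degree two. -/
theorem exists_negative_transverse (hT : ∀ v w, herm (T v) (T w) = herm v w)
    (hp : herm p p = 0) (hp1 : p (Sum.inr ()) = 1) (hTp : T p = p) :
    ∃ y t : Fin n ⊕ Unit → ℂ, ∃ s : ℂ, (herm y y).re < 0 ∧ herm y p = -1 ∧
      T y = y + t ∧ T t = t + s • p := by
  obtain ⟨v, hv, s, hs⟩ := exists_transverse hT hp hp1 hTp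
  set a : ℂ := -(herm v p)⁻¹ with ha
  -- Adding c p lowers the norm of a v by 2c, which brings it to -2.
  set c : ℝ := (herm (a • v) (a • v)).re / 2 + 1 with hc
  have h1 : herm (a • v) p = -1 := by
    rw [herm_smul_left, ha, neg_mul, inv_mul_cancel₀ hv]
  have h2 : herm p (a • v) = -1 := by rw [← star_herm, h1]; simp
  refine ⟨a • v + (c : ℂ) • p, a • (T v - v), a * s, ?_, ?_, ?_, ?_⟩
  · rw [herm_add_left, herm_add_right, herm_add_right, herm_smul_left (c : ℂ),
      herm_smul_right (c : ℂ), herm_smul_left (c : ℂ), herm_smul_right (c : ℂ), h1, h2, hp]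
    simp only [mul_zero, add_zero, Complex.add_re, Complex.mul_re, Complex.neg_re, Complex.one_re,
      Complex.neg_im, Complex.one_im, Complex.ofReal_re, neg_zero, sub_zero, Complex.star_def,
      Complex.conj_re]
    linarith
  · rw [herm_add_left, h1, herm_smul_left, hp, mul_zero, add_zero]
  · rw [map_add, map_smul, map_smul, hTp, smul_sub]; abel
  · rw [map_smul, mul_smul, ← hs, ← smul_add]; congr 1; abel

end Isometry

/-! ### A convexity criterion for sums of two squares. -/

section Convex

/-- A positive convex quadratic polynomial and an affine function, not both constant, have a
strictly convex sum of squares. -/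
theorem strictConvexOn_sq_add_sq {P : ℝ → ℝ} {a b c d e : ℝ} (hPe : ∀ x, P x = a * x ^ 2 + b * x + c)
    (hP : ∀ x, 0 < P x) (ha : 0 ≤ a) (had : a = 0 → d ≠ 0) :
    StrictConvexOn ℝ Set.univ fun x => P x ^ 2 + (d * x + e) ^ 2 := by
  refine ⟨convex_univ, fun x _ y _ hxy s t hs ht hst => ?_⟩
  simp only [smul_eq_mul]
  set D := (x - y) ^ 2 with hD
  have hDpos : 0 < D := by have := sub_ne_zero.2 hxy; positivity
  have hst' : 0 < s * t := mul_pos hs ht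
  have h1 : s * P x + t * P y = P (s * x + t * y) + a * (s * t) * D := by
    obtain rfl : t = 1 - s := by linarith
    rw [hPe, hPe, hPe, hD]; ring
  -- The convexity defect is a sum of nonnegative terms: the first is positive if a > 0, the last if
  -- d ≠ 0.
  have h2 : s * (P x ^ 2 + (d * x + e) ^ 2) + t * (P y ^ 2 + (d * y + e) ^ 2) -
      (P (s * x + t * y) ^ 2 + (d * (s * x + t * y) + e) ^ 2) =
      2 * P (s * x + t * y) * (a * (s * t) * D) + (a * (s * t) * D) ^ 2 +
      s * t * (P x - P y) ^ 2 + s * t * d ^ 2 * D := by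
    have h3 : s * P x ^ 2 + t * P y ^ 2 =
        (P (s * x + t * y) + a * (s * t) * D) ^ 2 + s * t * (P x - P y) ^ 2 := by
      rw [← h1]
      obtain rfl : t = 1 - s := by linarith
      ring
    have h4 : s * (d * x + e) ^ 2 + t * (d * y + e) ^ 2 =
        (d * (s * x + t * y) + e) ^ 2 + s * t * d ^ 2 * D := by
      obtain rfl : t = 1 - s := by linarith
      rw [hD]; ring
    linear_combination h3 + h4
  have hm := hP (s * x + t * y)
  have h5 : 0 < 2 * P (s * x + t * y) * (a * (s * t) * D) + (a * (s * t) * D) ^ 2 +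
      s * t * (P x - P y) ^ 2 + s * t * d ^ 2 * D := by
    rcases ha.eq_or_lt with h0 | h0
    · have := had h0.symm
      rw [← h0]; positivity
    · positivity
  linarith

end Convex

/-! ### From points of the ball to vectors, and the orbit curve. -/

section Orbit

variable {n : ℕ}

theorem herm_homog_neg (z : CH n) : (herm (homog z.1) (homog z.1)).re < 0 := by
  have hz : ‖z.1‖ < 1 := mem_ball_zero_iff.1 z.2
  rw [herm_homog_self, Complex.ofReal_re]
  nlinarith [norm_nonneg z.1]

theorem norm_dehomog_lt_one {v : Fin n ⊕ Unit → ℂ} (hv : (herm v v).re < 0) :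
    ‖dehomog v‖ < 1 := by
  have h0 : v (Sum.inr ()) ≠ 0 := last_ne_zero_of_nonpos (by
    rintro rfl; simp [herm_zero_left] at hv) hv.le
  have h1 := norm_dehomog v
  rw [if_neg h0] at h1
  rw [herm_self, Complex.ofReal_re, ← h1] at hv
  have h2 : 0 < ‖v (Sum.inr ())‖ := norm_pos_iff.2 h0
  by_contra! hc
  nlinarith [mul_nonneg (show 0 ≤ ‖dehomog v‖ ^ 2 - 1 by nlinarith) (sq_nonneg ‖v (Sum.inr ())‖)]

theorem norm_dehomog_le_one {v : Fin n ⊕ Unit → ℂ} (h0 : v (Sum.inr ()) ≠ 0)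
    (hv : (herm v v).re ≤ 0) : ‖dehomog v‖ ≤ 1 := by
  have h1 := norm_dehomog v
  rw [if_neg h0] at h1
  rw [herm_self, Complex.ofReal_re, ← h1] at hv
  have h2 : 0 < ‖v (Sum.inr ())‖ ^ 2 := by have := norm_pos_iff.2 h0; positivity
  by_contra! hc
  nlinarith [mul_pos (show 0 < ‖dehomog v‖ ^ 2 - 1 by nlinarith) h2]

/-- Every negative vector represents a point of the ball. -/
theorem exists_homog_eq_smul {v : Fin n ⊕ Unit → ℂ} (hv : (herm v v).re < 0) :
    ∃ z : CH n, ∃ c : ℂ, c ≠ 0 ∧ homog z.1 = c • v := by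
  have h0 : v (Sum.inr ()) ≠ 0 := last_ne_zero_of_nonpos (by
    rintro rfl; simp [herm_zero_left] at hv) hv.le
  exact ⟨⟨dehomog v, mem_ball_zero_iff.2 (norm_dehomog_lt_one hv)⟩, _, inv_ne_zero h0,
    homog_dehomog v h0⟩

theorem mulVec_homog_of_fixed {A : U n} {q : CHbar n} (h : (A : PU n) • q = q) :
    ∃ l : ℂ, l ≠ 0 ∧ A.1.val *ᵥ homog q.1 = l • homog q.1 := by
  have h0 := last_ne_zero A q
  refine ⟨_, h0, ?_⟩
  have h1 := homog_dehomog _ h0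
  have h2 : dehomog (A.1.val *ᵥ homog q.1) = q.1 := congrArg Subtype.val h
  rw [h2] at h1
  nth_rewrite 3 [h1]
  rw [smul_smul, mul_inv_cancel₀ h0, one_smul]

/-- A nonpositive eigenvector represents a fixed point in the closed ball. -/
theorem exists_fixed_of_eigenvector {A : U n} {w : Fin n ⊕ Unit → ℂ} {m : ℂ} (hw : w ≠ 0)
    (hww : (herm w w).re ≤ 0) (hm : m ≠ 0) (hA : A.1.val *ᵥ w = m • w) :
    ∃ q : CHbar n, (A : PU n) • q = q ∧ w = w (Sum.inr ()) • homog q.1 := by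
  have h0 := last_ne_zero_of_nonpos hw hww
  refine ⟨⟨dehomog w, mem_closedBall_zero_iff.2 (norm_dehomog_le_one h0 hww)⟩, ?_, ?_⟩
  · apply Subtype.ext
    rw [mk_smul]
    change dehomog (A.1.val *ᵥ homog (dehomog w)) = dehomog w
    rw [homog_dehomog w h0, Matrix.mulVec_smul, hA, smul_smul,
      dehomog_smul _ (mul_ne_zero (inv_ne_zero h0) hm)]
  · change w = w (Sum.inr ()) • homog (dehomog w)
    rw [homog_dehomog w h0, smul_smul, mul_inv_cancel₀ h0, one_smul]

theorem herm_homog_smul (A : U n) (y : CH n) :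
    ∃ c : ℂ, c ≠ 0 ∧ homog ((A : PU n) • y).1 = c • (A.1.val *ᵥ homog y.1) :=
  ⟨_, inv_ne_zero (last_ne_zero A (toBar y)), homog_dehomog _ (last_ne_zero A (toBar y))⟩

/-- The distance formula is homogeneous in the second vector. -/
theorem bdist_eq_of_homog_eq_smul (z w : CH n) {c : ℂ} {v : Fin n ⊕ Unit → ℂ}
    (h : homog w.1 = c • v) :
    bdist z w = 2 * Real.arcosh (‖herm (homog z.1) v‖ /
      √((herm (homog z.1) (homog z.1)).re * (herm v v).re)) := by
  have hc : c ≠ 0 := by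
    rintro rfl
    simpa [homog] using congrFun h (Sum.inr ())
  have hcn : ‖c‖ ≠ 0 := by simpa using hc
  rw [bdist, h, herm_smul_self_re, herm_smul_right, norm_mul, norm_star, mul_left_comm,
    Real.sqrt_mul (by positivity), Real.sqrt_sq (norm_nonneg c), mul_div_mul_left _ _ hcn]

/-- Bisectors are nonempty. -/
theorem bisector_nonempty (y y' : CH n) : (bisector y y').Nonempty := by
  set u := homog y.1 with hu
  -- Rescaling by r gives the lift of y' the same norm as that of y.
  set r : ℝ := √((herm u u).re / (herm (homog y'.1) (homog y'.1)).re) with hr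
  have h1 : (herm u u).re < 0 := herm_homog_neg y
  have h2 := herm_homog_neg y'
  have hr0 : 0 < r := Real.sqrt_pos.2 (div_pos_of_neg_of_neg h1 h2)
  have hr2 : r * r = (herm u u).re / (herm (homog y'.1) (homog y'.1)).re :=
    Real.mul_self_sqrt (div_pos_of_neg_of_neg h1 h2).le
  set v := (r : ℂ) • homog y'.1 with hv
  have huv : herm u u = herm v v := by
    rw [hv, herm_smul_left, herm_smul_right, herm_self_eq_re u, herm_self_eq_re (homog y'.1)]
    simp only [Complex.star_def, Complex.conj_ofReal]
    rw [← mul_assoc]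
    norm_cast
    rw [hr2, div_mul_cancel₀ _ h2.ne]
  obtain ⟨x, hx, hxe⟩ := exists_equidistant h1 huv
  obtain ⟨z, c, hc, hz⟩ := exists_homog_eq_smul hx
  refine ⟨z, ?_⟩
  have hy' : homog y'.1 = (r : ℂ)⁻¹ • v := by
    rw [hv, smul_smul, inv_mul_cancel₀ (by exact_mod_cast hr0.ne'), one_smul]
  change bdist z y = bdist z y'
  rw [bdist_eq_of_homog_eq_smul z y (one_smul ℂ _).symm, bdist_eq_of_homog_eq_smul z y' hy',
    ← huv, hz, ← hu, herm_smul_left c x u, herm_smul_left c x v, norm_mul, norm_mul, hxe]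

/-- The polynomial parametrisation of the orbit of `y` under `y ↦ y + t`, `t ↦ t + s p`, `p ↦ p`. -/
noncomputable def orbitCurve (y t p : Fin n ⊕ Unit → ℂ) (s : ℂ) (x : ℝ) : Fin n ⊕ Unit → ℂ :=
  y + (x : ℂ) • t + ((x : ℂ) * (x - 1) / 2 * s) • p

theorem map_orbitCurve {T : (Fin n ⊕ Unit → ℂ) →ₗ[ℂ] (Fin n ⊕ Unit → ℂ)}
    {y t p : Fin n ⊕ Unit → ℂ} {s : ℂ} (hTp : T p = p) (hTy : T y = y + t)
    (hTt : T t = t + s • p) (x : ℝ) :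
    T (orbitCurve y t p s x) = orbitCurve y t p s (x + 1) := by
  simp only [orbitCurve, map_add, map_smul, hTp, hTy, hTt]
  push_cast
  module

section Curve

variable {T : (Fin n ⊕ Unit → ℂ) →ₗ[ℂ] (Fin n ⊕ Unit → ℂ)} {y t p : Fin n ⊕ Unit → ℂ} {s : ℂ}

theorem herm_orbitCurve_right (w : Fin n ⊕ Unit → ℂ) (x : ℝ) :
    herm w (orbitCurve y t p s x) =
      herm w y + x * herm w t + x * (x - 1) / 2 * star s * herm w p := by
  have h : star ((x : ℂ) * (x - 1) / 2 * s) = (x : ℂ) * (x - 1) / 2 * star s := by simp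
  have h' : star (x : ℂ) = x := Complex.conj_ofReal x
  rw [orbitCurve, herm_add_right, herm_add_right, herm_smul_right, herm_smul_right, h, h']

theorem herm_displacement (hT : ∀ v w, herm (T v) (T w) = herm v w) (hTp : T p = p)
    (hTy : T y = y + t) : herm t p = 0 := by
  have h := hT y p
  rw [hTp, hTy, herm_add_left] at h
  linear_combination h

/-- Expand ⟨T y, T t⟩ = ⟨y,t⟩. Thus s is real, which keeps the imaginary part of a pairing along the
curve affine. -/
theorem star_eq_herm_displacement (hT : ∀ v w, herm (T v) (T w) = herm v w) (hTp : T p = p)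
    (hyp : herm y p = -1) (hTy : T y = y + t) (hTt : T t = t + s • p) : star s = herm t t := by
  have h := hT y t
  rw [hTy, hTt, herm_add_left, herm_add_right, herm_add_right, herm_smul_right, herm_smul_right,
    hyp, herm_displacement hT hTp hTy] at h
  linear_combination -h

theorem herm_displacement_add (hT : ∀ v w, herm (T v) (T w) = herm v w) (hTy : T y = y + t) :
    2 * (herm y t).re + (herm t t).re = 0 := by
  have h := congrArg Complex.re (hT y y)
  rw [hTy, herm_add_left, herm_add_right, herm_add_right] at h
  simp only [Complex.add_re] at h
  linarith [herm_re_comm y t]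

/-- The x² terms cancel because s = ⟨t,t⟩, the x terms by `herm_displacement_add`. Real x is needed
for convexity, beyond the integer points of the orbit. -/
theorem herm_orbitCurve_self (hT : ∀ v w, herm (T v) (T w) = herm v w) (hp : herm p p = 0)
    (hTp : T p = p) (hyp : herm y p = -1) (hTy : T y = y + t) (hTt : T t = t + s • p) (x : ℝ) :
    (herm (orbitCurve y t p s x) (orbitCurve y t p s x)).re = (herm y y).re := by
  have htp := herm_displacement hT hTp hTy
  have hss := star_eq_herm_displacement hT hTp hyp hTy hTt
  have hadd := herm_displacement_add hT hTy
  have hpy : herm p y = -1 := by rw [← star_herm, hyp]; simp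
  have hpt : herm p t = 0 := by rw [← star_herm, htp, star_zero]
  have hs : s = herm t t := by rw [← star_star s, hss, star_herm]
  have hw : ∀ w, herm (orbitCurve y t p s x) w =
      herm y w + x * herm t w + x * (x - 1) / 2 * s * herm p w := by
    intro w
    simp only [orbitCurve, herm_add_left, herm_smul_left]
  rw [herm_orbitCurve_right, hw, hw, hw, hyp, hpy, htp, hpt, hp, hss, hs, herm_self_eq_re t]
  have : ((x : ℂ) * (x - 1) / 2) = ((x * (x - 1) / 2 : ℝ) : ℂ) := by push_cast; ring
  rw [this]
  simp only [Complex.add_re, Complex.re_ofReal_mul, mul_neg, mul_one, mul_zero,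
    add_zero, Complex.neg_re, Complex.ofReal_re]
  linear_combination x * hadd + x * herm_re_comm t y

/-- The squared pairing with a negative vector is strictly convex along the orbit. -/
theorem strictConvexOn_herm_orbitCurve (hT : ∀ v w, herm (T v) (T w) = herm v w)
    (hp : herm p p = 0) (hp1 : p (Sum.inr ()) = 1) (hTp : T p = p)
    (hyy : (herm y y).re < 0) (hyp : herm y p = -1) (hTy : T y = y + t) (hTt : T t = t + s • p)
    (ht : t ≠ 0) {z : Fin n ⊕ Unit → ℂ} (hzz : (herm z z).re < 0) (hzp : herm z p = -1) :
    StrictConvexOn ℝ Set.univ fun x : ℝ => ‖herm z (orbitCurve y t p s x)‖ ^ 2 := by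
  have htp := herm_displacement hT hTp hTy
  have hss := star_eq_herm_displacement hT hTp hyp hTy hTt
  have hadd := herm_displacement_add hT hTy
  have htt := herm_self_of_orthogonal_null hp hp1 htp
  have hval : ∀ x : ℝ, herm z (orbitCurve y t p s x) =
      herm z y + x * herm z t - ((x * (x - 1) / 2 * (herm t t).re : ℝ) : ℂ) := by
    intro x
    rw [herm_orbitCurve_right, hzp, hss, herm_self_eq_re t]
    push_cast
    rw [Complex.ofReal_re]
    ring
  have hre : ∀ x : ℝ, (herm z (orbitCurve y t p s x)).re =
      (herm z y).re + x * (herm z t).re - x * (x - 1) / 2 * (herm t t).re := by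
    intro x
    rw [hval]
    simp only [Complex.sub_re, Complex.add_re, Complex.re_ofReal_mul, Complex.ofReal_re]
  have him : ∀ x : ℝ, (herm z (orbitCurve y t p s x)).im =
      (herm z t).im * x + (herm z y).im := by
    intro x
    rw [hval]
    simp only [Complex.sub_im, Complex.add_im, Complex.im_ofReal_mul, Complex.ofReal_im]
    ring
  -- As z - w is orthogonal to p, its norm is nonnegative, so 2 Re⟨z,w⟩ ≤ ⟨z,z⟩ + ⟨w,w⟩ < 0.
  have hpos : ∀ x : ℝ, 0 < -(herm z (orbitCurve y t p s x)).re := by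
    intro x
    set w := orbitCurve y t p s x with hw
    have hwp : herm w p = -1 := by
      simp only [hw, orbitCurve, herm_add_left, herm_smul_left, hyp, htp, hp]; ring
    have h1 := (herm_self_of_orthogonal_null hp hp1 (v := z - w)
      (by rw [herm_sub_left, hzp, hwp, sub_self])).1
    have h2 : (herm w w).re = (herm y y).re := herm_orbitCurve_self hT hp hTp hyp hTy hTt x
    rw [herm_sub_left, herm_sub_right, herm_sub_right] at h1
    simp only [Complex.sub_re] at h1
    linarith [herm_re_comm z w]
  have hF : (fun x : ℝ => ‖herm z (orbitCurve y t p s x)‖ ^ 2) = fun x : ℝ =>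
      (-(herm z (orbitCurve y t p s x)).re) ^ 2 + ((herm z t).im * x + (herm z y).im) ^ 2 := by
    funext x
    rw [← him, ← Complex.normSq_eq_norm_sq, Complex.normSq_apply]
    ring
  rw [hF]
  refine strictConvexOn_sq_add_sq (a := (herm t t).re / 2)
    (b := -(herm z t).re - (herm t t).re / 2) (c := -(herm z y).re) (fun x => ?_) hpos
    (by linarith [htt.1]) ?_
  · rw [hre]; ring
  -- In the degenerate case t = c p: constancy of the norm gives Re c = 0, a constant imaginary part
  -- gives Im c = 0, against t ≠ 0.
  · intro h0 him0
    have h0' : (herm t t).re = 0 := by linarith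
    obtain ⟨c, rfl⟩ := htt.2 h0'
    have hc1 : (herm y (c • p)).re = 0 := by linarith
    rw [herm_smul_right, hyp] at hc1
    rw [herm_smul_right, hzp] at him0
    simp at hc1 him0
    exact ht (by rw [Complex.ext hc1 him0 (w := 0), zero_smul])

end Curve

/-- Along the orbit of a suitable point, the distance to any point is an increasing function of a
strictly convex function of the exponent. -/
theorem exists_strictConvex_orbit {g : PU n} (hg : IsParabolic g) :
    ∃ y : CH n, ∃ F : CH n → ℝ → ℝ, (∀ z, StrictConvexOn ℝ Set.univ (F z)) ∧
      ∀ z (j k : ℤ), bdist z (g ^ j • y) ≤ bdist z (g ^ k • y) ↔ F z j ≤ F z k := by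
  obtain ⟨q, hq1, hq⟩ := hg
  induction g using QuotientGroup.induction_on with
  | H A =>
  set p := homog q.1 with hpdef
  have hp : herm p p = 0 := by rw [hpdef, herm_homog_self, hq1]; simp
  have hp1 : p (Sum.inr ()) = 1 := rfl
  obtain ⟨l, hl0, hAp⟩ := mulVec_homog_of_fixed ((hq q).2 rfl)
  have huniq : ∀ (w : Fin n ⊕ Unit → ℂ) (m : ℂ), w ≠ 0 → (herm w w).re ≤ 0 → m ≠ 0 →
      A.1.val *ᵥ w = m • w → ∃ c : ℂ, w = c • p := by
    intro w m hw hww hm hA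
    obtain ⟨q', hq', hwq⟩ := exists_fixed_of_eigenvector hw hww hm hA
    rw [(hq q').1 hq'] at hwq
    exact ⟨_, hwq⟩
  have hl : ‖l‖ = 1 := by
    by_contra hl
    obtain ⟨w, m, hw, hm, hww, hAw, hne⟩ :=
      exists_null_eigenvector (T := Matrix.mulVecLin A.1.val) A.2 hp1 hl0 hl hAp
    obtain ⟨c, hc⟩ := huniq w m hw (by simp [hww]) hm hAw
    exact hne c hc
  have hll : l⁻¹ * star l⁻¹ = 1 := by simpa [hl] using Complex.mul_conj' l⁻¹
  set T : (Fin n ⊕ Unit → ℂ) →ₗ[ℂ] (Fin n ⊕ Unit → ℂ) := l⁻¹ • Matrix.mulVecLin A.1.val with hTdef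
  have hTv : ∀ v, A.1.val *ᵥ v = l • T v := fun v => by
    rw [hTdef, LinearMap.smul_apply, smul_smul, mul_inv_cancel₀ hl0, one_smul]; rfl
  have hT : ∀ v w, herm (T v) (T w) = herm v w := by
    intro v w
    have h1 : herm (T v) (T w) = l⁻¹ * (star l⁻¹ * herm (A.1.val *ᵥ v) (A.1.val *ᵥ w)) := by
      rw [hTdef, ← herm_smul_right, ← herm_smul_left]; rfl
    rw [h1, ← mul_assoc, hll, one_mul]
    exact A.2 v w
  have hTp : T p = p := by
    have := hTv p
    rw [hAp] at this
    exact (smul_right_injective _ hl0 this).symm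
  obtain ⟨v, t, s, hvv, hvp, hTv', hTt⟩ := exists_negative_transverse hT hp hp1 hTp
  -- If t = 0, the negative vector v is an eigenvector, hence a multiple of the null vector p.
  have ht : t ≠ 0 := by
    rintro rfl
    rw [add_zero] at hTv'
    have hv0 : v ≠ 0 := by rintro rfl; simp [herm_zero_left] at hvv
    obtain ⟨c, rfl⟩ := huniq v l hv0 hvv.le hl0 (by rw [hTv, hTv'])
    simp [herm_smul_left, hp] at hvp
  obtain ⟨y, c, hc, hy⟩ := exists_homog_eq_smul hvv
  have hpow : ∀ k : ℤ, ∃ m : ℂ, (A ^ k).1.val *ᵥ v = m • orbitCurve v t p s k := by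
    have hstep : ∀ (x : ℝ), A.1.val *ᵥ orbitCurve v t p s x = l • orbitCurve v t p s (x + 1) :=
      fun x => by rw [hTv, map_orbitCurve hTp hTv' hTt]
    intro k
    induction k using Int.induction_on with
    | zero => exact ⟨1, by simp [orbitCurve]⟩
    | succ i ih =>
      obtain ⟨m, hm⟩ := ih
      refine ⟨m * l, ?_⟩
      have : (A ^ ((i : ℤ) + 1)).1.val *ᵥ v = A.1.val *ᵥ ((A ^ (i : ℤ)).1.val *ᵥ v) := by
        rw [Matrix.mulVec_mulVec, add_comm, zpow_add, zpow_one]; rfl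
      rw [this, hm, Matrix.mulVec_smul, hstep, smul_smul]
      push_cast
      rfl
    | pred i ih =>
      obtain ⟨m, hm⟩ := ih
      refine ⟨m * l⁻¹, ?_⟩
      have : (A ^ (-(i : ℤ) - 1)).1.val *ᵥ v =
          (A⁻¹).1.val *ᵥ ((A ^ (-(i : ℤ))).1.val *ᵥ v) := by
        rw [Matrix.mulVec_mulVec, sub_eq_add_neg, add_comm, zpow_add, zpow_neg_one]; rfl
      have h2 := hstep ((-(i : ℤ) - 1 : ℤ) : ℝ)
      have h3 : (((-(i : ℤ) - 1 : ℤ) : ℝ) + 1) = ((-(i : ℤ) : ℤ) : ℝ) := by push_cast; ring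
      rw [h3] at h2
      have h4 : (A⁻¹).1.val *ᵥ (A.1.val *ᵥ orbitCurve v t p s ((-(i : ℤ) - 1 : ℤ) : ℝ)) =
          orbitCurve v t p s ((-(i : ℤ) - 1 : ℤ) : ℝ) := by
        rw [Matrix.mulVec_mulVec]
        have : (A⁻¹).1.val * A.1.val = 1 := Units.inv_mul A.1
        rw [this, Matrix.one_mulVec]
      rw [h2, Matrix.mulVec_smul] at h4
      rw [this, hm, Matrix.mulVec_smul, mul_smul, ← h4, smul_smul l⁻¹, inv_mul_cancel₀ hl0,
        one_smul]
  -- The factor on z achieves ⟨z,p⟩ = -1; it does not depend on x, so comparisons of distances are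
  -- unaffected.
  refine ⟨y, fun z x => ‖herm ((-(herm (homog z.1) p)⁻¹) • homog z.1)
    (orbitCurve v t p s x)‖ ^ 2, fun z => ?_, fun z j k => ?_⟩
  · have h0 := herm_null_ne_zero hp hp1 (herm_homog_neg z)
    refine strictConvexOn_herm_orbitCurve hT hp hp1 hTp hvv hvp hTv' hTt ht ?_ ?_
    · have h1 : 0 < ‖-(herm (homog z.1) p)⁻¹‖ := norm_pos_iff.2 (neg_ne_zero.2 (inv_ne_zero h0))
      rw [herm_smul_self_re]
      exact mul_neg_of_pos_of_neg (by positivity) (herm_homog_neg z)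
    · rw [herm_smul_left, neg_mul, inv_mul_cancel₀ h0]
  · have h0 := herm_null_ne_zero hp hp1 (herm_homog_neg z)
    have hself : ∀ k : ℤ, (herm (orbitCurve v t p s k) (orbitCurve v t p s k)).re =
        (herm v v).re := fun k => herm_orbitCurve_self hT hp hTp hvp hTv' hTt k
    set D := √((herm (homog z.1) (homog z.1)).re * (herm v v).re) with hD
    have hDpos : 0 < D := Real.sqrt_pos.2 (mul_pos_of_neg_of_neg (herm_homog_neg z) hvv)
    have hdist : ∀ k : ℤ, bdist z ((A : PU n) ^ k • y) =
        2 * Real.arcosh (‖herm (homog z.1) (orbitCurve v t p s k)‖ / D) := by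
      intro k
      obtain ⟨m, hm⟩ := hpow k
      obtain ⟨b, hb, hbk⟩ := herm_homog_smul (A ^ k) y
      rw [hy, Matrix.mulVec_smul, hm, smul_smul, smul_smul] at hbk
      have := bdist_eq_of_homog_eq_smul z _ hbk
      rw [hself] at this
      exact this
    -- `Real.arcosh` is compared on positive arguments, so the bound that they are at least 1 is not
    -- needed.
    have hpos : ∀ k : ℤ, 0 < ‖herm (homog z.1) (orbitCurve v t p s k)‖ / D := fun k =>
      div_pos (norm_pos_iff.2 (herm_ne_zero_of_neg (herm_homog_neg z) ((hself k).trans_lt hvv)))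
        hDpos
    rw [hdist, hdist, mul_le_mul_iff_right₀ two_pos, Real.arcosh_le_arcosh (hpos j) (hpos k),
      div_le_div_iff_of_pos_right hDpos]
    simp only [herm_smul_left, norm_mul, mul_pow]
    have h1 : 0 < ‖-(herm (homog z.1) p)⁻¹‖ := norm_pos_iff.2 (neg_ne_zero.2 (inv_ne_zero h0))
    rw [mul_le_mul_iff_right₀ (by positivity), sq_le_sq₀ (norm_nonneg _) (norm_nonneg _)]

end Orbit

end ComplexHyperbolic

/-! ### Strictly convex functions at the integers. -/

section StrictConvex

/-- A strictly convex function that does not decrease from `0` to both neighbouring integers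
increases strictly from `0` to every other integer. -/
theorem StrictConvexOn.lt_of_le_one {F : ℝ → ℝ} (hF : StrictConvexOn ℝ Set.univ F)
    {x : ℝ} (hx : 1 < x) (h1 : F 0 ≤ F 1) : F 0 < F x := by
  -- Writes 1 as the convex combination of 0 and x with weight 1/x on x.
  have h := hF.2 (Set.mem_univ 0) (Set.mem_univ x) (by linarith)
    (sub_pos.2 (inv_lt_one_of_one_lt₀ hx)) (by positivity : 0 < x⁻¹) (by ring)
  have hx' : x⁻¹ * x = 1 := inv_mul_cancel₀ (by linarith)
  simp only [smul_eq_mul, mul_zero, zero_add, hx'] at h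
  have hpos : 0 < x⁻¹ := by positivity
  nlinarith

theorem StrictConvexOn.comp_neg_univ {F : ℝ → ℝ} (hF : StrictConvexOn ℝ Set.univ F) :
    StrictConvexOn ℝ Set.univ fun x => F (-x) := by
  refine ⟨convex_univ, fun x _ y _ hxy a b ha hb hab => ?_⟩
  have := hF.2 (Set.mem_univ (-x)) (Set.mem_univ (-y)) (neg_injective.ne hxy) ha hb hab
  simpa only [smul_eq_mul, mul_neg, neg_add] using this

theorem StrictConvexOn.lt_of_le_neg_one {F : ℝ → ℝ} (hF : StrictConvexOn ℝ Set.univ F)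
    {x : ℝ} (hx : x < -1) (h1 : F 0 ≤ F (-1)) : F 0 < F x := by
  simpa using (hF.comp_neg_univ).lt_of_le_one (x := -x) (by linarith) (by simpa using h1)

/-- Because 0 is the midpoint of -1 and 1. This puts the bisector for g inside the polyhedron and
off the bisector for g⁻¹. -/
theorem StrictConvexOn.lt_neg_one_of_le {F : ℝ → ℝ} (hF : StrictConvexOn ℝ Set.univ F)
    (h1 : F 1 ≤ F 0) : F 0 < F (-1) := by
  have h := hF.2 (Set.mem_univ (-1)) (Set.mem_univ 1) (by norm_num)
    (by norm_num : (0 : ℝ) < 1 / 2) (by norm_num : (0 : ℝ) < 1 / 2) (by norm_num)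
  norm_num at h
  linarith

end StrictConvex

namespace ComplexHyperbolic

/-! ### The two sides. -/

section Sides

variable {n : ℕ}

theorem IsParabolic.smul_ne {g : PU n} (hg : IsParabolic g) (y : CH n) : g • y ≠ y := by
  obtain ⟨p, hp1, hp⟩ := hg
  intro h
  have h0 : (g • toBar y).1 = (toBar y).1 := congrArg (fun w : CH n => w.1) h
  have h1 : toBar y = p := (hp (toBar y)).1 (Subtype.ext h0)
  have h2 : ‖y.1‖ < 1 := mem_ball_zero_iff.1 y.2
  rw [← h1] at hp1
  exact h2.ne hp1

/-- The Dirichlet polyhedron of a cyclic parabolic group, centred at a suitable point, has exactly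
the bisectors of the generator and of its inverse as sides. -/
theorem setOf_isSide_zpowers_eq_pair {g : PU n} (hg : IsParabolic g) :
    ∃ y : CH n, {S | IsSide (Subgroup.zpowers g) y S} =
      {bisector y (g • y), bisector y (g⁻¹ • y)} ∧
      bisector y (g • y) ≠ bisector y (g⁻¹ • y) := by
  obtain ⟨y, F, hF, hFd⟩ := exists_strictConvex_orbit hg
  have hle : ∀ z (k : ℤ), bdist z y ≤ bdist z (g ^ k • y) ↔ F z 0 ≤ F z k := fun z k => by
    simpa using hFd z 0 k
  have heq : ∀ z (k : ℤ), z ∈ bisector y (g ^ k • y) ↔ F z 0 = F z k := fun z k => by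
    have h2 : bdist z (g ^ k • y) ≤ bdist z y ↔ F z k ≤ F z 0 := by simpa using hFd z k 0
    change bdist z y = bdist z (g ^ k • y) ↔ _
    rw [le_antisymm_iff, hle, h2, ← le_antisymm_iff]
  have hD : ∀ z, z ∈ dirichlet (Subgroup.zpowers g) y ↔ ∀ k : ℤ, F z 0 ≤ F z k := by
    intro z
    constructor
    · exact fun h k => (hle z k).1 (h _ (Subgroup.zpow_mem_zpowers g k))
    · rintro h _ ⟨k, rfl⟩
      exact (hle z k).2 (h k)
  have hlt : ∀ z, F z 0 ≤ F z 1 → F z 0 ≤ F z (-1) → ∀ k : ℤ, k ≠ 0 → k ≠ 1 → k ≠ -1 →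
      F z 0 < F z k := by
    intro z h1 h2 k hk0 hk1 hk2
    rcases lt_or_gt_of_ne hk0 with hk | hk
    · exact (hF z).lt_of_le_neg_one (by exact_mod_cast (by omega : k < -1)) h2
    · exact (hF z).lt_of_le_one (by exact_mod_cast (by omega : 1 < k)) h1
  have hmem : ∀ z, F z 0 ≤ F z 1 → F z 0 ≤ F z (-1) →
      z ∈ dirichlet (Subgroup.zpowers g) y := by
    intro z h1 h2
    refine (hD z).2 fun k => ?_
    by_cases hk0 : k = 0
    · simp [hk0]
    by_cases hk1 : k = 1
    · simpa [hk1] using h1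
    by_cases hk2 : k = -1
    · simpa [hk2] using h2
    exact (hlt z h1 h2 k hk0 hk1 hk2).le
  have hB1 : ∀ z, z ∈ bisector y (g • y) ↔ F z 0 = F z 1 := fun z => by simpa using heq z 1
  have hB2 : ∀ z, z ∈ bisector y (g⁻¹ • y) ↔ F z 0 = F z (-1) := fun z => by
    simpa using heq z (-1)
  have hsub1 : bisector y (g • y) ⊆ dirichlet (Subgroup.zpowers g) y := fun z hz =>
    hmem z ((hB1 z).1 hz).le ((hF z).lt_neg_one_of_le ((hB1 z).1 hz).ge).le
  have hsub2 : bisector y (g⁻¹ • y) ⊆ dirichlet (Subgroup.zpowers g) y := fun z hz =>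
    hmem z (by simpa using ((hF z).comp_neg_univ.lt_neg_one_of_le
      (by simpa using ((hB2 z).1 hz).ge)).le) ((hB2 z).1 hz).le
  -- A bisector contained in the polyhedron is its own intersection with it, so the whole space
  -- serves as the open set.
  have hside : ∀ h ∈ Subgroup.zpowers g, h • y ≠ y →
      bisector y (h • y) ⊆ dirichlet (Subgroup.zpowers g) y →
      IsSide (Subgroup.zpowers g) y (bisector y (h • y)) := fun h hh hy hs =>
    ⟨h, hh, hy, (Set.inter_eq_right.2 hs).symm, Set.univ, isOpen_univ,
      by simpa using bisector_nonempty _ _, by simp⟩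
  refine ⟨y, Set.ext fun S => ⟨?_, ?_⟩, fun h => ?_⟩
  · rintro ⟨_, ⟨k, rfl⟩, hky, rfl, V, -, hne, hV⟩
    beta_reduce at hky hne hV ⊢
    by_cases hk1 : k = 1
    · left
      rw [hk1, zpow_one, Set.inter_eq_right.2 hsub1]
    by_cases hk2 : k = -1
    · right
      rw [hk2, zpow_neg_one, Set.inter_eq_right.2 hsub2]
      rfl
    -- For every other k the bisector misses the polyhedron altogether.
    exfalso
    have hk0 : k ≠ 0 := by rintro rfl; simp at hky
    obtain ⟨z, hz⟩ := hne
    have hz' := hV hz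
    have h1 := (hD z).1 hz'.1
    exact (hlt z (by simpa using h1 1) (by simpa using h1 (-1)) k hk0 hk1 hk2).ne
      ((heq z k).1 hz'.2)
  · rintro (rfl | rfl)
    · exact hside g (Subgroup.mem_zpowers g) (hg.smul_ne y) hsub1
    · exact hside g⁻¹ (inv_mem (Subgroup.mem_zpowers g))
        (fun h => hg.smul_ne y (inv_smul_eq_iff.1 h).symm) hsub2
  · obtain ⟨z, hz⟩ := bisector_nonempty y (g • y)
    have h1 := (hF z).lt_neg_one_of_le ((hB1 z).1 hz).ge
    exact h1.ne ((hB2 z).1 (h ▸ hz))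

end Sides

end ComplexHyperbolic

theorem theorem3p1 (n : ℕ) (G : Subgroup (ComplexHyperbolic.PU n)) (hG : DiscreteTopology G)
    (hgen : ∃ g : ComplexHyperbolic.PU n,
      ComplexHyperbolic.IsParabolic g ∧ G = Subgroup.zpowers g) :
    ∃ y₀ : ComplexHyperbolic.CH n,
      {S : Set (ComplexHyperbolic.CH n) | ComplexHyperbolic.IsSide G y₀ S}.ncard = 2 := by
  obtain ⟨g, hg, rfl⟩ := hgen
  obtain ⟨y, hy, hne⟩ := ComplexHyperbolic.setOf_isSide_zpowers_eq_pair hg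
  exact ⟨y, by rw [hy, Set.ncard_pair hne]⟩
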